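/- Let $R$ be an integral domain and let $G$ be a nontrivial abelian group (written additively). An integral domain is called atomic if every nonzero nonunit is a finite product of irreducible elements, and it is called hereditarily atomic if each of its subrings (containing the same identity element) is atomic. If the group algebra $R[G]$ is a hereditarily atomic integral domain, then $R[G]$ satisfies the ascending chain condition on principal ideals (ACCP): every ascending chain $I_0 \subseteq I_1 \subseteq I_2 \subseteq \cdots$ of principal ideals of $R[G]$ eventually stabilizes. -/

import Mathlib

/-- An integral domain is atomic if every nonzero nonunit is a (finite) product of irreducible
elements. -/
def IsAtomicDomain (A : Type*) [CommRing A] : Prop :=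
  IsDomain A ∧
    ∀ a : A, a ≠ 0 → ¬ IsUnit a →
      ∃ s : Multiset A, (∀ b ∈ s, Irreducible b) ∧ s.prod = a

/-- A hereditarily atomic domain: an integral domain all of whose subrings (with the same
identity element) are atomic domains. -/
def IsHereditarilyAtomicDomain (A : Type*) [CommRing A] : Prop :=
  IsDomain A ∧ ∀ S : Subring A, IsAtomicDomain S

/-- The ascending chain condition on principal ideals: every ascending sequence of principal
ideals is eventually constant. -/
def SatisfiesACCP (A : Type*) [CommRing A] : Prop :=
  ∀ I : ℕ → Ideal A, (∀ n, (I n).IsPrincipal) → (∀ n, I n ≤ I (n + 1)) →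
    ∃ N, ∀ n, N ≤ n → I n = I N

/-! A domain `R[G]` forces `G` to be torsion-free, hence linearly orderable. For an ideal `J` of
`R`, the elements whose negative-exponent coefficients lie in `J` form a subring, atomic by
hypothesis; write `X^g` for monomials. If `J` is a nonzero prime and `0 ≠ t ∈ J`, every factor of
the constant `t` is a monomial, and one with coefficient in `J` is reducible since any `X^j`, `j >
0`, splits off. Irreducible factors thus have coefficients outside `J`, and so would `t`; hence `R`
is a field. For `J = ⊥`, an irreducible factor of `X^g`, `g > 0`, has the least positive exponent,
which then generates `G`. So `R[G]` is a finitely generated algebra over a field, hence Noetherian.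
-/

open AddMonoidAlgebra in
/-- If the group algebra is a domain, then the group is torsion-free. -/
theorem AddMonoidAlgebra.isAddTorsionFree_of_isDomain (R : Type*) [CommRing R]
    {G : Type*} [AddCommGroup G] [IsDomain (AddMonoidAlgebra R G)] : IsAddTorsionFree G := by
  classical
  have hR : Nontrivial R := by
    by_contra hR
    rw [not_nontrivial_iff_subsingleton] at hR
    exact zero_ne_one (α := AddMonoidAlgebra R G) (by ext; exact Subsingleton.elim _ _)
  have key : ∀ g : G, IsOfFinAddOrder g → g = 0 := by
    intro g hg
    have hpos := hg.addOrderOf_pos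
    -- With `n` the order of `g`, `(∑ i < n, X^(i•g)) * (X^g - 1) = X^(n•g) - 1 = 0`; the sum is
    -- nonzero because only `i = 0` contributes at exponent `0`.
    have h := geom_sum_mul (single g (1 : R)) (addOrderOf g)
    rw [single_pow, addOrderOf_nsmul_eq_zero, one_pow, ← one_def, sub_self] at h
    rcases mul_eq_zero.mp h with h | h
    · exfalso
      have h0 : (∑ i ∈ Finset.range (addOrderOf g), single g (1 : R) ^ i).coeff 0 = 1 := by
        rw [coeff_sum, Finsupp.finsetSum_apply, Finset.sum_eq_single 0]
        · simp
        · intro i hi hi0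
          rw [single_pow, coeff_single, Finsupp.single_apply, if_neg]
          intro h
          exact hi0 (Nat.eq_zero_of_dvd_of_lt (addOrderOf_dvd_of_nsmul_eq_zero h)
            (Finset.mem_range.mp hi))
        · intro h
          exact absurd (Finset.mem_range.mpr hpos) h
      rw [h] at h0
      simp at h0
    · rw [sub_eq_zero, one_def] at h
      exact single_left_injective one_ne_zero h
  refine ⟨fun n hn a b hab => ?_⟩
  rw [← sub_eq_zero]
  refine key _ (isOfFinAddOrder_iff_nsmul_eq_zero.mpr ⟨n, Nat.pos_of_ne_zero hn, ?_⟩)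
  simpa [nsmul_sub, sub_eq_zero] using hab

/-- A torsion-free abelian group admits a compatible linear order. -/
theorem IsAddTorsionFree.exists_linearOrder (G : Type*) [AddCommGroup G] [IsAddTorsionFree G] :
    ∃ _ : LinearOrder G, IsOrderedAddMonoid G := by
  classical
  -- The order is lexicographic in coordinates of the divisible hull, a `ℚ`-vector space containing
  -- `G`.
  let ι := Module.Basis.ofVectorSpaceIndex ℚ (DivisibleHull G)
  let B : Module.Basis ι ℚ (DivisibleHull G) := Module.Basis.ofVectorSpace ℚ (DivisibleHull G)
  let : LinearOrder ι := linearOrderOfSTO WellOrderingRel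
  let f : G → Lex (ι →₀ ℚ) := fun g => toLex (B.repr (DivisibleHull.coeAddMonoidHom G g))
  have hf : Function.Injective f := fun a b h =>
    DivisibleHull.coe_injective (B.repr.injective (toLex.injective h))
  have hadd : ∀ a b, f (a + b) = f a + f b := fun a b => by simp [f]
  refine ⟨LinearOrder.lift' f hf, ?_⟩
  let := LinearOrder.lift' f hf
  refine ⟨fun a b (h : f a ≤ f b) c => ?_, fun a b (h : f a ≤ f b) c => ?_⟩
  · change f (a + c) ≤ f (b + c)
    rw [hadd, hadd]
    exact add_le_add_left h _
  · change f (c + a) ≤ f (c + b)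
    rw [hadd, hadd]
    exact add_le_add_right h _

namespace AddMonoidAlgebra

/-- Factors of a nonzero monomial are monomials. -/
theorem exists_single_of_mul_eq_single {R G : Type*} [CommRing R] [IsDomain R] [AddCommGroup G]
    [TwoUniqueSums G] {p q : AddMonoidAlgebra R G} {g : G} {r : R} (hr : r ≠ 0)
    (h : p * q = single g r) :
    ∃ a c b d, p = single a c ∧ q = single b d ∧ a + b = g ∧ c * d = r := by
  have hpq : p * q ≠ 0 := by rw [h]; simpa using hr
  have hp : 0 < p.coeff.support.card := by
    rw [Finset.card_pos, Finsupp.support_nonempty_iff]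
    exact fun h0 => left_ne_zero_of_mul hpq (coeff_eq_zero.mp h0)
  have hq : 0 < q.coeff.support.card := by
    rw [Finset.card_pos, Finsupp.support_nonempty_iff]
    exact fun h0 => right_ne_zero_of_mul hpq (coeff_eq_zero.mp h0)
  have hsum : ∀ s ∈ p.coeff.support ×ˢ q.coeff.support,
      UniqueAdd p.coeff.support q.coeff.support s.1 s.2 → s.1 + s.2 = g := by
    intro s hs hu
    rw [Finset.mem_product] at hs
    have h1 := coeff_mul_add_of_uniqueAdd hu
    by_contra hne
    rw [h, coeff_single, Finsupp.single_eq_of_ne hne] at h1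
    exact mul_ne_zero (Finsupp.mem_support_iff.mp hs.1) (Finsupp.mem_support_iff.mp hs.2) h1.symm
  -- Otherwise two distinct pairs have unique sums; both sums equal `g`, contradicting uniqueness.
  have hcard : ¬ 1 < p.coeff.support.card * q.coeff.support.card := by
    intro hlt
    obtain ⟨s, hs, t, ht, hst, hus, hut⟩ := TwoUniqueSums.uniqueAdd_of_one_lt_card hlt
    have e := (hsum s hs hus).trans (hsum t ht hut).symm
    rw [Finset.mem_product] at hs
    have := hut hs.1 hs.2 e
    exact hst (Prod.ext this.1 this.2)
  have hp1 : p.coeff.support.card ≤ 1 := by nlinarith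
  have hq1 : q.coeff.support.card ≤ 1 := by nlinarith
  obtain ⟨a, c, hc⟩ := Finsupp.card_support_le_one'.mp hp1
  obtain ⟨b, d, hd⟩ := Finsupp.card_support_le_one'.mp hq1
  have hp' : p = single a c := coeff_injective hc
  have hq' : q = single b d := coeff_injective hd
  have h2 := h
  rw [hp', hq', single_mul_single] at h2
  have h3 := congrArg coeff h2
  rw [coeff_single, coeff_single, Finsupp.single_eq_single_iff] at h3
  rcases h3 with h3 | h3
  · exact ⟨a, c, b, d, hp', hq', h3.1, h3.2⟩
  · exact absurd h3.2 hr

section Cone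

variable {R G : Type*} [CommRing R] [AddCommGroup G] [LinearOrder G] [IsOrderedAddMonoid G]

/-- The elements of the group algebra whose coefficients at negative exponents lie in `J`. -/
def coneSubring (G : Type*) [AddCommGroup G] [LinearOrder G] [IsOrderedAddMonoid G]
    (J : Ideal R) : Subring (AddMonoidAlgebra R G) where
  carrier := {f | ∀ g < 0, f.coeff g ∈ J}
  mul_mem' := by
    classical
    intro x y hx hy g hg
    rw [coeff_mul]
    refine Ideal.sum_mem _ fun a _ => Ideal.sum_mem _ fun b _ => ?_
    dsimp only
    split_ifs with hab
    · rcases lt_or_ge a 0 with ha | ha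
      · exact J.mul_mem_right _ (hx a ha)
      · refine J.mul_mem_left _ (hy b ?_)
        by_contra hb
        exact absurd (add_nonneg ha (not_lt.mp hb)) (by rw [hab]; exact not_le.mpr hg)
    · exact J.zero_mem
  one_mem' := by
    intro g hg
    rw [one_def, coeff_single, Finsupp.single_eq_of_ne hg.ne]
    exact J.zero_mem
  add_mem' := fun hx hy g hg => by
    simpa using J.add_mem (hx g hg) (hy g hg)
  zero_mem' := fun g _ => by simp
  neg_mem' := fun hx g hg => by
    simpa using J.neg_mem (hx g hg)

theorem single_mem_coneSubring {J : Ideal R} {k : G} {c : R} :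
    single k c ∈ coneSubring G J ↔ 0 ≤ k ∨ c ∈ J := by
  constructor
  · intro h
    rcases lt_or_ge k 0 with hk | hk
    · right
      simpa using h k hk
    · exact Or.inl hk
  · intro h g hg
    rw [coeff_single]
    by_cases hgk : g = k
    · subst hgk
      simpa using h.resolve_left (not_le.mpr hg)
    · rw [Finsupp.single_eq_of_ne hgk]
      exact J.zero_mem

variable [IsDomain R] {J : Ideal R}

/-- The inverse is a monomial whose coefficient is a unit, hence outside `J`, so its exponent `-k`
is nonnegative. -/
theorem isUnit_and_nonpos_of_isUnit_coneSubring (hJ : J ≠ ⊤) {u : coneSubring G J} (hu : IsUnit u)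
    {k : G} {c : R} (huk : (u : AddMonoidAlgebra R G) = single k c) : IsUnit c ∧ k ≤ 0 := by
  obtain ⟨v, hv⟩ := hu.exists_right_inv
  have hv' : (u : AddMonoidAlgebra R G) * (v : AddMonoidAlgebra R G) = single 0 1 := by
    rw [← one_def]; exact congrArg Subtype.val hv
  obtain ⟨a, c', b, d, h1, h2, h3, h4⟩ := exists_single_of_mul_eq_single one_ne_zero hv'
  have hd : d ∉ J := fun hd => hJ (J.eq_top_iff_one.mpr (h4 ▸ J.mul_mem_left c' hd))
  have hb : 0 ≤ b := (single_mem_coneSubring.mp (h2 ▸ v.2)).resolve_right hd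
  have hc' : c' ≠ 0 := left_ne_zero_of_mul (h4 ▸ one_ne_zero)
  have e := congrArg coeff (huk.symm.trans h1)
  rw [coeff_single, coeff_single, Finsupp.single_eq_single_iff] at e
  obtain ⟨rfl, rfl⟩ := e.resolve_right fun e => hc' e.2
  refine ⟨IsUnit.of_mul_eq_one d h4, ?_⟩
  rw [eq_neg_of_add_eq_zero_left h3]
  exact neg_nonpos.mpr hb

/-- A monomial that is divisible by a smaller positive power is reducible. -/
theorem not_irreducible_coneSubring (hJ : J ≠ ⊤) {b : coneSubring G J} {j k : G} {c : R}
    (hb : (b : AddMonoidAlgebra R G) = single k c) (hj : 0 < j) (h : c ∈ J ∨ j < k) :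
    ¬ Irreducible b := by
  intro hirr
  have h1 : single j (1 : R) ∈ coneSubring G J := single_mem_coneSubring.mpr (Or.inl hj.le)
  have h2 : single (k - j) c ∈ coneSubring G J :=
    single_mem_coneSubring.mpr (h.symm.imp_left fun h => (sub_pos.mpr h).le)
  have hfac : b = ⟨_, h1⟩ * ⟨_, h2⟩ := by
    apply Subtype.ext
    rw [hb]
    simp [single_mul_single]
  rcases hirr.isUnit_or_isUnit hfac with hu | hu
  · exact absurd (isUnit_and_nonpos_of_isUnit_coneSubring hJ hu rfl).2 (not_le.mpr hj)
  · have := isUnit_and_nonpos_of_isUnit_coneSubring hJ hu rfl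
    rcases h with h | h
    · exact hJ (Ideal.eq_top_of_isUnit_mem _ h this.1)
    · exact absurd this.2 (not_le.mpr (sub_pos.mpr h))

theorem exists_single_of_mem_of_prod_eq_single {s : Multiset (coneSubring G J)}
    {g : G} {r : R} (hr : r ≠ 0) (hs : (s.prod : AddMonoidAlgebra R G) = single g r)
    {b : coneSubring G J} (hb : b ∈ s) :
    ∃ k c, (b : AddMonoidAlgebra R G) = single k c ∧ c ∣ r := by
  obtain ⟨q, hq⟩ := Multiset.dvd_prod hb
  rw [hq, Subring.coe_mul] at hs
  obtain ⟨a, c, _, d, h1, _, _, h4⟩ := exists_single_of_mul_eq_single hr hs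
  exact ⟨a, c, h1, d, h4.symm⟩

/-- If the cone subrings of nonzero primes are atomic, then the coefficient ring is a field. -/
theorem isField_of_isAtomicDomain_coneSubring [Nontrivial G]
    (h : ∀ J : Ideal R, IsAtomicDomain (coneSubring G J)) : IsField R := by
  by_contra hR
  obtain ⟨J, hJ0, hJ⟩ := Ring.not_isField_iff_exists_prime.mp hR
  obtain ⟨t, htJ, ht0⟩ := Submodule.exists_mem_ne_zero_of_ne_bot hJ0
  obtain ⟨j, hj⟩ := exists_zero_lt (α := G)
  have htS : single (0 : G) t ∈ coneSubring G J := single_mem_coneSubring.mpr (Or.inl le_rfl)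
  obtain ⟨s, hs, hst⟩ := (h J).2 ⟨_, htS⟩
    (fun h0 => ht0 (by simpa using congrArg Subtype.val h0))
    (fun hu => hJ.ne_top (Ideal.eq_top_of_isUnit_mem _ htJ
      (isUnit_and_nonpos_of_isUnit_coneSubring hJ.ne_top hu rfl).1))
  have hst' : (s.prod : AddMonoidAlgebra R G) = single 0 t := congrArg Subtype.val hst
  -- Primality of `J` keeps the coefficient of the product outside `J`.
  have hprod : ∀ s : Multiset (coneSubring G J),
      (∀ b ∈ s, ∃ k c, (b : AddMonoidAlgebra R G) = single k c ∧ c ∉ J) →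
      ∃ k c, (s.prod : AddMonoidAlgebra R G) = single k c ∧ c ∉ J := by
    intro s
    induction s using Multiset.induction with
    | empty => exact fun _ => ⟨0, 1, by simp [one_def], hJ.one_notMem⟩
    | cons b s ih =>
      intro hb
      obtain ⟨k, c, h1, h2⟩ := hb b (Multiset.mem_cons_self _ _)
      obtain ⟨k', c', h3, h4⟩ := ih fun b hbs => hb b (Multiset.mem_cons_of_mem hbs)
      refine ⟨k + k', c * c', ?_, fun hc => (hJ.mem_or_mem hc).elim h2 h4⟩
      rw [Multiset.prod_cons, Subring.coe_mul, h1, h3, single_mul_single]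
  obtain ⟨k, c, h1, h2⟩ := hprod s fun b hb => by
    obtain ⟨k, c, h1, -⟩ := exists_single_of_mem_of_prod_eq_single ht0 hst' hb
    exact ⟨k, c, h1, fun hc =>
      not_irreducible_coneSubring hJ.ne_top h1 hj (Or.inl hc) (hs b hb)⟩
  have e := congrArg coeff (hst'.symm.trans h1)
  rw [coeff_single, coeff_single, Finsupp.single_eq_single_iff] at e
  rcases e with e | e
  · exact h2 (e.2 ▸ htJ)
  · exact ht0 e.1

/-- If the monoid algebra of the nonnegative cone is atomic, then the group is cyclic. -/
theorem isAddCyclic_of_isAtomicDomain_coneSubring [Nontrivial G]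
    (h : IsAtomicDomain (coneSubring G (⊥ : Ideal R))) : IsAddCyclic G := by
  have hfac : ∀ g : G, 0 < g → ∃ s : Multiset (coneSubring G (⊥ : Ideal R)),
      (s.prod : AddMonoidAlgebra R G) = single g 1 ∧ s ≠ 0 ∧
      ∀ b ∈ s, ∃ k c, (b : AddMonoidAlgebra R G) = single k c ∧ 0 < k ∧ ∀ j, 0 < j → k ≤ j := by
    intro g hg
    have hgS : single g (1 : R) ∈ coneSubring G (⊥ : Ideal R) :=
      single_mem_coneSubring.mpr (Or.inl hg.le)
    obtain ⟨s, hs, hsg⟩ := h.2 ⟨_, hgS⟩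
      (fun h0 => one_ne_zero (α := R) (by simpa using congrArg Subtype.val h0))
      (fun hu => absurd (isUnit_and_nonpos_of_isUnit_coneSubring bot_ne_top hu rfl).2
        (not_le.mpr hg))
    have hsg' : (s.prod : AddMonoidAlgebra R G) = single g 1 := congrArg Subtype.val hsg
    refine ⟨s, hsg', ?_, fun b hb => ?_⟩
    · rintro rfl
      have e : single (0 : G) (1 : R) = single g 1 := by simpa [one_def] using hsg'
      exact hg.ne (single_left_injective one_ne_zero e)
    · obtain ⟨k, c, h1, h2⟩ := exists_single_of_mem_of_prod_eq_single one_ne_zero hsg' hb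
      obtain ⟨d, hd⟩ := h2
      have hc0 : c ≠ 0 := left_ne_zero_of_mul (hd ▸ one_ne_zero)
      have hk : 0 ≤ k := (single_mem_coneSubring.mp (h1 ▸ b.2)).resolve_right (by simpa using hc0)
      refine ⟨k, c, h1, hk.lt_of_ne ?_, fun j hj => ?_⟩
      · rintro rfl
        refine (hs b hb).not_isUnit (IsUnit.of_mul_eq_one
          ⟨single 0 d, single_mem_coneSubring.mpr (Or.inl le_rfl)⟩ (Subtype.ext ?_))
        rw [Subring.coe_mul, h1, single_mul_single, ← hd, add_zero, Subring.coe_one, one_def]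
      · by_contra hlt
        exact not_irreducible_coneSubring bot_ne_top h1 hj (Or.inr (not_le.mp hlt)) (hs b hb)
  obtain ⟨g₀, hg₀⟩ := exists_zero_lt (α := G)
  obtain ⟨s₀, -, hs₀, hk₀⟩ := hfac g₀ hg₀
  obtain ⟨b₀, hb₀⟩ := Multiset.exists_mem_of_ne_zero hs₀
  -- `k` is the least positive element of `G`, so every irreducible factor of any `X^g` with `g > 0`
  -- has exponent `k`.
  obtain ⟨k, -, -, hk, hmin⟩ := hk₀ b₀ hb₀
  have hprod : ∀ s : Multiset (coneSubring G (⊥ : Ideal R)),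
      (∀ b ∈ s, ∃ c, (b : AddMonoidAlgebra R G) = single k c) →
      ∃ (n : ℕ) (c : R), (s.prod : AddMonoidAlgebra R G) = single (n • k) c := by
    intro s
    induction s using Multiset.induction with
    | empty => exact fun _ => ⟨0, 1, by simp [one_def]⟩
    | cons b s ih =>
      intro hb
      obtain ⟨c, h1⟩ := hb b (Multiset.mem_cons_self _ _)
      obtain ⟨n, c', h3⟩ := ih fun b hbs => hb b (Multiset.mem_cons_of_mem hbs)
      refine ⟨n + 1, c * c', ?_⟩
      rw [Multiset.prod_cons, Subring.coe_mul, h1, h3, single_mul_single, succ_nsmul']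
  have hpos : ∀ g : G, 0 < g → g ∈ AddSubgroup.zmultiples k := by
    intro g hg
    obtain ⟨s, hs, -, hsk⟩ := hfac g hg
    obtain ⟨n, c, hn⟩ := hprod s fun b hb => by
      obtain ⟨k', c, h1, h2, h3⟩ := hsk b hb
      exact ⟨c, by rw [h1, le_antisymm (h3 k hk) (hmin k' h2)]⟩
    have e := congrArg coeff (hs.symm.trans hn)
    rw [coeff_single, coeff_single, Finsupp.single_eq_single_iff] at e
    rw [(e.resolve_right fun e => one_ne_zero e.1).1]
    exact AddSubgroup.nsmul_mem _ (AddSubgroup.mem_zmultiples k) n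
  refine ⟨k, fun g => ?_⟩
  rcases lt_trichotomy g 0 with hg | rfl | hg
  · exact neg_mem_iff.mp (hpos (-g) (neg_pos.mpr hg))
  · exact (AddSubgroup.zmultiples k).zero_mem
  · exact hpos g hg

end Cone

end AddMonoidAlgebra

theorem SatisfiesACCP.of_isNoetherianRing (A : Type*) [CommRing A] [IsNoetherianRing A] :
    SatisfiesACCP A := by
  intro I _ hI
  obtain ⟨N, hN⟩ := monotone_stabilizes_iff_noetherian.mpr ‹IsNoetherianRing A›
    ⟨I, monotone_nat_of_le_succ hI⟩
  exact ⟨N, fun n hn => (hN n hn).symm⟩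

theorem mainTheorem5 {R : Type*} [CommRing R] [IsDomain R]
    {G : Type*} [AddCommGroup G] [Nontrivial G]
    (h : IsHereditarilyAtomicDomain (AddMonoidAlgebra R G)) :
    SatisfiesACCP (AddMonoidAlgebra R G) := by
  have := h.1
  have := AddMonoidAlgebra.isAddTorsionFree_of_isDomain R (G := G)
  obtain ⟨_, _⟩ := IsAddTorsionFree.exists_linearOrder G
  let _ := (AddMonoidAlgebra.isField_of_isAtomicDomain_coneSubring (R := R) (G := G)
    fun J => h.2 _).toField
  have : IsAddCyclic G := AddMonoidAlgebra.isAddCyclic_of_isAtomicDomain_coneSubring (h.2 _)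
  have : AddMonoid.FG G := by
    obtain ⟨k, hk⟩ := IsAddCyclic.exists_generator (α := G)
    refine AddGroup.fg_iff_addMonoid_fg.mp (AddGroup.fg_iff.mpr ⟨{k}, ?_, Set.finite_singleton k⟩)
    rw [← AddSubgroup.zmultiples_eq_closure]
    exact (AddSubgroup.eq_top_iff' _).mpr hk
  have : IsNoetherianRing (AddMonoidAlgebra R G) := Algebra.FiniteType.isNoetherianRing R _
  exact SatisfiesACCP.of_isNoetherianRing _
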